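/- Let $\mathcal X,\mathcal A$ be finite sets of states and actions and let $P(x,a,y)$ be the transition probabilities of a Markov decision process on them. Let $E$ (goal states) and $U$ (forbidden states) be disjoint subsets of $\mathcal X$, let $H=\mathcal X\setminus(E\cup U)$, and put $\kappa(x,a)=\sum_{y\in U}P(x,a,y)$. Let $\tau$ be the hitting time of $E\cup U$. Assume that there is a deterministic $\tau_{\max}<\infty$ such that $\tau\le\tau_{\max}$ with probability one under every stationary randomised policy and from every initial state, and let $\mathscr T\ge\tau_{\max}$ be an integer. Let $w\in(0,1)$, let $K$ be a number of episodes, and let $\bar x\in H$. Every episode starts at $\bar x$ and is stopped as soon as $E\cup U$ is reached (and after at most $\mathscr T$ transitions). Throughout episode $k$ a stationary randomised policy $\pi_k$ is applied; it is chosen by an arbitrary rule as a function of the transitions recorded in the episodes $1,\dots,k-1$ (for instance, the solution of an optimistic linear program built from these data if it is feasible, and a safe baseline policy otherwise). Let $N_k(x,a)$ and $N_k(x,a,y)$ be the numbers of visits to $(x,a)$ and of transitions $(x,a,y)$ recorded before episode $k$. Write $u\vee v=\max(u,v)$ and define $$\hat P_k(x,a,y)=\frac{N_k(x,a,y)}{N_k(x,a)\vee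 1},\qquad \hat\kappa_k(x,a)=\sum_{y\in U}\hat P_k(x,a,y),$$ $$\epsilon_k(x,a,y)=\sqrt{\frac{4\hat P_k(x,a,y)\bigl(1-\hat P_k(x,a,y)\bigr)\log\frac{2|\mathcal X||\mathcal A|K}{w}}{N_k(x,a)\vee 1}}+\frac{14\log\frac{2|\mathcal X||\mathcal A|K}{w}}{3\bigl((N_k(x,a)-1)\vee 1\bigr)},\qquad \hat\epsilon_k(x,a)=\sum_{y\in\mathcal X}\epsilon_k(x,a,y).$$ Let $G_k$ be the confidence set of all real arrays $\tilde P$ on $\mathcal X\times\mathcal A\times\mathcal X$ with $\sum_{y}\tilde P(x,a,y)=1$ for all $(x,a)\in\mathcal X\times\mathcal A$ and $|\tilde P(x,a,y)-\hat P_k(x,a,y)|\le\epsilon_k(x,a,y)$ for all $(x,a,y)\in H\times\mathcal A\times\mathcal X$. Then, with probability at least $1-2w$, the following hold simultaneously for all $(x,a,y)\in H\times\mathcal A\times\mathcal X$ and all $k\in\{1,\dots,K\}$: 1. $|P(x,a,y)-\hat P_k(x,a,y)|\le\epsilon_k(x,a,y)$; 2. $|P(x,a,y)-\tilde P(x,a,y)|\le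 2\epsilon_k(x,a,y)$ for every $\tilde P\in G_k$ (in particular for every optimistic $\tilde P$, that is, one that attains the maximum of an optimisation problem over $G_k$); 3. $\kappa(x,a)\le\hat\kappa_k(x,a)+\hat\epsilon_k(x,a)$. -/

import Mathlib

noncomputable section

namespace PSafe

/-- Probability of the event `s` under the discrete law `p`. -/
def prob {α : Type*} (p : PMF α) (s : Set α) : ℝ :=
  (p.toOuterMeasure s).toReal

/-- A transition `(x, a, y)`: action `a` is applied in state `x`, the next state is `y`. -/
abbrev Transition (S A : Type*) := S × A × S

/-- A (stationary, randomised) policy: a map from states to probability laws on actions. -/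
abbrev Policy (S A : Type*) := S → PMF A

/-- The taboo set `H`: the states that are neither goal states (`E`) nor forbidden (`U`). -/
def taboo {S : Type*} [Fintype S] [DecidableEq S] (E U : Finset S) : Finset S := (E ∪ U)ᶜ

/-- The law of `(X_0, …, X_n)` for the (unstopped) chain started at `x`, with transition
probabilities `P` and actions drawn from the policy `π`. -/
def stateLaw {S A : Type*} (P : S → A → PMF S) (π : Policy S A) : ℕ → S → PMF (List S)
  | 0, x => PMF.pure [x]
  | n + 1, x =>
      (π x).bind fun a => (P x a).bind fun y => (stateLaw P π n y).map fun l => x :: l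

/-- Under every policy and from every initial state, the hitting time `τ` of `E ∪ U` satisfies
`τ ≤ n` with probability one (that is, one of `X_0, …, X_n` lies in `E ∪ U`). -/
def StopsBy {S A : Type*} [DecidableEq S] (P : S → A → PMF S) (E U : Finset S) (n : ℕ) : Prop :=
  ∀ (π : Policy S A) (x : S), prob (stateLaw P π n x) {l | ∃ y ∈ l, y ∈ E ∪ U} = 1

/-- The law of the transitions recorded in one episode that starts at `x`, follows `π`, is stopped
as soon as a state outside `H` is reached, and has at most `n` transitions. -/
def episodeLaw {S A : Type*} [DecidableEq S] (P : S → A → PMF S) (H : Finset S)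
    (π : Policy S A) : ℕ → S → PMF (List (Transition S A))
  | 0, _ => PMF.pure []
  | n + 1, x =>
      if x ∈ H then
        (π x).bind fun a => (P x a).bind fun y =>
          (episodeLaw P H π n y).map fun l => (x, a, y) :: l
      else PMF.pure []

/-- The joint law of the records of the first `k` episodes (listed in order). Every episode starts
at `x₀`; the policy used in an episode is chosen by `learner` from the records of all earlier
episodes and is kept during the episode. -/
def runLaw {S A : Type*} [DecidableEq S] (P : S → A → PMF S) (H : Finset S)
    (learner : List (List (Transition S A)) → Policy S A) (T : ℕ) (x₀ : S) :
    ℕ → PMF (List (List (Transition S A)))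
  | 0 => PMF.pure []
  | k + 1 => (runLaw P H learner T x₀ k).bind fun h =>
      (episodeLaw P H (learner h) T x₀).map fun e => h ++ [e]

/-- The transitions observed before episode `k` (episodes are numbered from `1`). -/
def dataBefore {S A : Type*} (h : List (List (Transition S A))) (k : ℕ) :
    List (Transition S A) :=
  (h.take (k - 1)).flatten

section Estimates

variable {S A : Type*} [Fintype S] [DecidableEq S] [Fintype A] [DecidableEq A]

/-- `N(x, a)`: the number of visits to `(x, a)` in the data `d`. -/
def visits (d : List (Transition S A)) (x : S) (a : A) : ℕ :=
  d.countP fun e => e.1 = x ∧ e.2.1 = a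

/-- `N(x, a, y)`: the number of transitions `(x, a, y)` in the data `d`. -/
def visitsTo (d : List (Transition S A)) (x : S) (a : A) (y : S) : ℕ :=
  d.countP fun e => e.1 = x ∧ e.2.1 = a ∧ e.2.2 = y

/-- The estimate `P̂(x, a, y) = N(x, a, y) / (N(x, a) ∨ 1)`. -/
def estP (d : List (Transition S A)) (x : S) (a : A) (y : S) : ℝ :=
  (visitsTo d x a y : ℝ) / max (visits d x a : ℝ) 1

/-- `log (2 |X| |A| K / w)`. -/
def logTerm (S A : Type*) [Fintype S] [Fintype A] (K : ℕ) (w : ℝ) : ℝ :=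
  Real.log (2 * (Fintype.card S : ℝ) * (Fintype.card A : ℝ) * (K : ℝ) / w)

/-- The empirical Bernstein radius `ε(x, a, y)`. -/
def radius (K : ℕ) (w : ℝ) (d : List (Transition S A)) (x : S) (a : A) (y : S) : ℝ :=
  Real.sqrt (4 * estP d x a y * (1 - estP d x a y) * logTerm S A K w / max (visits d x a : ℝ) 1)
    + 14 * logTerm S A K w / (3 * max ((visits d x a : ℝ) - 1) 1)

/-- `ε̂(x, a) = ∑_y ε(x, a, y)`. -/
def radiusSum (K : ℕ) (w : ℝ) (d : List (Transition S A)) (x : S) (a : A) : ℝ :=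
  ∑ y : S, radius K w d x a y

/-- `κ(x, a) = ∑_{y ∈ U} P(x, a, y)`. -/
def kappa (P : S → A → PMF S) (U : Finset S) (x : S) (a : A) : ℝ :=
  ∑ y ∈ U, (P x a y).toReal

/-- `κ̂(x, a) = ∑_{y ∈ U} P̂(x, a, y)`. -/
def estKappa (d : List (Transition S A)) (U : Finset S) (x : S) (a : A) : ℝ :=
  ∑ y ∈ U, estP d x a y

/-- The confidence set `G`: all `Q` whose rows sum to one and that are within `ε` of the
estimate `P̂`, which concerns the states in `H`. -/
def confidenceSet (H : Finset S) (K : ℕ) (w : ℝ) (d : List (Transition S A)) :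
    Set (S → A → S → ℝ) :=
  {Q | (∀ x a, ∑ y : S, Q x a y = 1) ∧
    ∀ x ∈ H, ∀ a y, |Q x a y - estP d x a y| ≤ radius K w d x a y}

end Estimates

end PSafe

end

/-! Fix a pair `(x, a)`. However the learner chooses its policies, each new visit to the pair is
followed by a fresh draw from `P x a`. Hence a product of weights over the first `n` visits, with
the mean weight `c` standing in for visits still to come, is a martingale of mean `c ^ n`, and
Markov's inequality gives a Chernoff bound at the `n`-th visit, uniformly in the episode
(`PSafe.runLaw_weight_tail`).

With exponential weights this becomes a Bernstein inequality with the true variance.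
`sub_le_of_bernstein` replaces that variance by the empirical one deterministically, so no
probability is spent on estimating it. With `L = logTerm S A K w`, each one-sided deviation at a
given `n` has probability at most `exp (-2L)`.

For the union bound `n` must have few values. As the hitting time is bounded under every policy, no
state of `H` lies on a cycle, so a pair is visited at most once per episode and `n < K` before each
of the `K` episodes (`PSafe.StopsBy.visits_dataBefore_le`). Fewer than `2|S|²|A|K` events of
probability `(w / (2|S||A|K))²` add up to at most `w`, which is within the allowed `2w`. The bounds
on confidence-set members and on `κ` follow from the first claim by the triangle inequality and by
summation. -/

/-! ### Bernstein's inequality for one Bernoulli variable -/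

theorem Real.exp_le_pade {x : ℝ} (h0 : 0 ≤ x) (h3 : x < 3) :
    Real.exp x ≤ 1 + x + x ^ 2 / (2 * (1 - x / 3)) := by
  -- The right-hand side equals `(6 + 4x + x²) / (6 - 2x)`. After clearing the denominator and
  -- multiplying by `exp (-x)`, the claim is that this function, which vanishes at `0`, is
  -- nonnegative; its derivative is nonnegative because `1 + t + t²/2 ≤ exp t`.
  have hmono : MonotoneOn (fun t : ℝ => Real.exp (-t) * (6 + 4 * t + t ^ 2) - (6 - 2 * t))
      (Set.Ici 0) := by
    have hd : ∀ t : ℝ, HasDerivAt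
        (fun t : ℝ => Real.exp (-t) * (6 + 4 * t + t ^ 2) - (6 - 2 * t))
        (2 - Real.exp (-t) * (t ^ 2 + 2 * t + 2)) t := by
      intro t
      have h1 : HasDerivAt (fun t : ℝ => Real.exp (-t)) (Real.exp (-t) * (-1)) t :=
        (hasDerivAt_neg t).exp
      have h2 : HasDerivAt (fun t : ℝ => 6 + 4 * t + t ^ 2) (4 + 2 * t) t := by
        have := (((hasDerivAt_id t).const_mul 4).const_add 6).add (hasDerivAt_pow 2 t)
        refine this.congr_deriv (by simp)
      have h3 : HasDerivAt (fun t : ℝ => 6 - 2 * t) (-2) t := by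
        have := ((hasDerivAt_id t).const_mul 2).const_sub 6
        refine this.congr_deriv (by simp)
      exact ((h1.mul h2).sub h3).congr_deriv (by ring)
    refine monotoneOn_of_deriv_nonneg (convex_Ici 0)
      (fun t _ => (hd t).continuousAt.continuousWithinAt)
      (fun t _ => (hd t).differentiableAt.differentiableWithinAt) ?_
    intro t ht
    rw [interior_Ici] at ht
    rw [(hd t).deriv]
    have h := Real.quadratic_le_exp_of_nonneg (le_of_lt ht)
    have h' : Real.exp (-t) * Real.exp t = 1 := by rw [← Real.exp_add]; simp
    nlinarith [Real.exp_pos (-t)]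
  have h := hmono (Set.mem_Ici.2 le_rfl) (Set.mem_Ici.2 h0) h0
  simp only [neg_zero, Real.exp_zero] at h
  have h' : Real.exp (-x) * Real.exp x = 1 := by rw [← Real.exp_add]; simp
  have hne : (3 - x) ≠ 0 := by linarith
  have e : 1 + x + x ^ 2 / (2 * (1 - x / 3)) = (6 + 4 * x + x ^ 2) / (6 - 2 * x) := by
    have : (1 - x / 3) ≠ 0 := by intro h; apply hne; linarith
    have h6 : (6 - 2 * x) ≠ 0 := by intro h; apply hne; linarith
    rw [eq_div_iff h6]
    field_simp
    ring
  rw [e, le_div_iff₀ (by linarith)]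
  nlinarith [Real.exp_pos x]

theorem Real.exp_le_quadratic_of_nonpos {x : ℝ} (hx : x ≤ 0) :
    Real.exp x ≤ 1 + x + x ^ 2 / 2 := by
  have h := Real.quadratic_le_exp_of_nonneg (neg_nonneg.2 hx)
  have h' : Real.exp (-x) * Real.exp x = 1 := by rw [← Real.exp_add]; simp
  have hp : 0 < 1 + x + x ^ 2 / 2 := by nlinarith [sq_nonneg (x + 1)]
  have h4 : 1 ≤ Real.exp (-x) * (1 + x + x ^ 2 / 2) := by
    nlinarith [mul_le_mul_of_nonneg_right h hp.le, sq_nonneg (x ^ 2)]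
  nlinarith [Real.exp_pos x]

/-- Bernstein's bound for the moment generating function of a centred Bernoulli variable. -/
theorem bernoulli_mgf_le {p l : ℝ} (hp0 : 0 ≤ p) (hp1 : p ≤ 1) (hl : 0 ≤ l) (hlp : l * p < 3) :
    (1 - p) * Real.exp (l * p) + p * Real.exp (-(l * (1 - p)))
      ≤ Real.exp (p * (1 - p) * l ^ 2 / (2 * (1 - l * p / 3))) := by
  have hq : 0 ≤ 1 - p := by linarith
  have hlp0 : 0 ≤ l * p := mul_nonneg hl hp0
  have h1 := Real.exp_le_pade hlp0 hlp
  have hD : 0 < 2 * (1 - l * p / 3) := by linarith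
  have h2 : Real.exp (-(l * (1 - p))) ≤
      1 + -(l * (1 - p)) + (l * (1 - p)) ^ 2 / (2 * (1 - l * p / 3)) := by
    have h := Real.exp_le_quadratic_of_nonpos (neg_nonpos.2 (mul_nonneg hl hq))
    have : (l * (1 - p)) ^ 2 / 2 ≤ (l * (1 - p)) ^ 2 / (2 * (1 - l * p / 3)) :=
      div_le_div_of_nonneg_left (sq_nonneg _) hD (by linarith)
    rw [neg_sq] at h
    linarith
  have h3 := Real.add_one_le_exp (p * (1 - p) * l ^ 2 / (2 * (1 - l * p / 3)))
  calc (1 - p) * Real.exp (l * p) + p * Real.exp (-(l * (1 - p)))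
      ≤ (1 - p) * (1 + l * p + (l * p) ^ 2 / (2 * (1 - l * p / 3)))
        + p * (1 + -(l * (1 - p)) + (l * (1 - p)) ^ 2 / (2 * (1 - l * p / 3))) := by
        gcongr
    _ = p * (1 - p) * l ^ 2 / (2 * (1 - l * p / 3)) + 1 := by
        ring
    _ ≤ _ := h3

/-- The centred variable `p - Bernoulli(p)` is at most `p`, not merely at most `1`, so the linear
Bernstein term carries a factor `p`. The `l` chosen below makes the exponent exactly `-2u`. -/
theorem exists_bernoulli_chernoff {p u : ℝ} (hp0 : 0 < p) (hp1 : p ≤ 1) (hu : 0 ≤ u) :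
    ∃ l : ℝ, 0 ≤ l ∧
      (1 - p) * Real.exp (l * (p - (2 * √(p * (1 - p) * u) + 2 * u * p / 3)))
        + p * Real.exp (l * (p - (2 * √(p * (1 - p) * u) + 2 * u * p / 3) - 1))
        ≤ Real.exp (-(2 * u)) := by
  rcases hp1.eq_or_lt with rfl | hp1
  -- For `p = 1` the variance vanishes; `3` is the limit of `σ / (1 + σ * p / 3)` as `σ → ∞`.
  · refine ⟨3, by norm_num, le_of_eq ?_⟩
    simp
    ring
  have hv : 0 < p * (1 - p) := mul_pos hp0 (by linarith)
  set v := p * (1 - p) with hvdef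
  set σ := 2 * √(u / v) with hσ
  have hσ0 : 0 ≤ σ := by positivity
  have hσ2 : v * σ ^ 2 = 4 * u := by
    rw [hσ, mul_pow, Real.sq_sqrt (by positivity)]
    field_simp
    ring
  have hvs : 2 * √(v * u) = v * σ := by
    have : v * u = v ^ 2 * (u / v) := by field_simp
    rw [this, Real.sqrt_mul (by positivity), Real.sqrt_sq hv.le, hσ]
    ring
  have hs : 0 < 1 + σ * p / 3 := by positivity
  refine ⟨σ / (1 + σ * p / 3), by positivity, ?_⟩
  set l := σ / (1 + σ * p / 3) with hl
  have hl0 : 0 ≤ l := by positivity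
  have hlp : l * p < 3 := by
    rw [hl, div_mul_eq_mul_div, div_lt_iff₀ hs]
    linarith
  have hinv : 1 - l * p / 3 = 1 / (1 + σ * p / 3) := by
    rw [hl]
    field_simp
    ring
  have hm := bernoulli_mgf_le hp0.le hp1.le hl0 hlp
  rw [← hvdef] at hm
  set d := 2 * √(v * u) + 2 * u * p / 3 with hd
  have e1 : Real.exp (l * (p - d)) = Real.exp (l * p) * Real.exp (-(l * d)) := by
    rw [← Real.exp_add]; ring_nf
  have e2 : Real.exp (l * (p - d - 1)) = Real.exp (-(l * (1 - p))) * Real.exp (-(l * d)) := by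
    rw [← Real.exp_add]; ring_nf
  have e3 : v * l ^ 2 / (2 * (1 - l * p / 3)) + -(l * d) = -(2 * u) := by
    have hu' : u = v * σ ^ 2 / 4 := by linarith
    rw [hinv, hd, hvs, hu', hl]
    field_simp
    ring
  calc _ = ((1 - p) * Real.exp (l * p) + p * Real.exp (-(l * (1 - p)))) * Real.exp (-(l * d)) := by
        rw [e1, e2]; ring
    _ ≤ Real.exp (v * l ^ 2 / (2 * (1 - l * p / 3))) * Real.exp (-(l * d)) := by gcongr
    _ = Real.exp (-(2 * u)) := by rw [← Real.exp_add, e3]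

/-- The variance in Bernstein's bound may be replaced by the empirical variance. -/
theorem sub_le_of_bernstein {p q u : ℝ} (hp1 : p ≤ 1) (hq0 : 0 ≤ q)
    (hqp : q ≤ p) (hu : 0 ≤ u) (h : p - q ≤ 2 * √(p * (1 - p) * u) + 2 * u * p / 3) :
    p - q ≤ 2 * √(q * (1 - q) * u) + 4 * u := by
  have hp0 : 0 ≤ p := hq0.trans hqp
  have hv : 0 ≤ p * (1 - p) := mul_nonneg hp0 (by linarith)
  have hw : 0 ≤ q * (1 - q) := mul_nonneg hq0 (by linarith)
  rw [Real.sqrt_mul hv] at h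
  rw [Real.sqrt_mul hw]
  have ha2 := Real.sq_sqrt hv
  have hb2 := Real.sq_sqrt hw
  have hs2 := Real.sq_sqrt hu
  have ha := Real.sqrt_nonneg (p * (1 - p))
  have hb := Real.sqrt_nonneg (q * (1 - q))
  have hs := Real.sqrt_nonneg u
  set a := √(p * (1 - p))
  set b := √(q * (1 - q))
  set s := √u
  have hr : 0 ≤ 1 - p := by linarith
  -- Here `a² - b² = (p - q)(1 - p - q) ≤ (1 - p)(p - q)`, so `h` yields a quadratic inequality in
  -- `a`. The product of the coefficients `2(1 - p) + p/3` and `p/3` dominates its constant term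
  -- `2p(1 - p)/3`.
  have key : a ≤ b + s * (2 * (1 - p) + p / 3) := by
    by_contra! hlt
    have h1 : a ^ 2 - b ^ 2 ≤ (1 - p) * (2 * (a * s) + 2 * u * p / 3) := by
      have : a ^ 2 - b ^ 2 ≤ (1 - p) * (p - q) := by
        rw [ha2, hb2]
        nlinarith [mul_nonneg (sub_nonneg.2 hqp) hq0]
      exact this.trans (mul_le_mul_of_nonneg_left h hr)
    have h2 : (b + s * (2 * (1 - p) + p / 3)) * (b + s * (p / 3)) ≤
        a * (a - 2 * (1 - p) * s) := by
      apply mul_le_mul hlt.le (by linarith) (by positivity) ha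
    have h3 : (b + s * (2 * (1 - p) + p / 3)) * (b + s * (p / 3)) <
        a * (a - 2 * (1 - p) * s) ∨ a = 0 := by
      rcases ha.eq_or_lt with h0 | h0
      · right; exact h0.symm
      · left
        calc _ ≤ a * (b + s * (p / 3)) :=
              mul_le_mul_of_nonneg_right hlt.le (by positivity)
          _ < _ := mul_lt_mul_of_pos_left (by linarith) h0
    rcases h3 with h3 | h3
    · have : 0 ≤ b * s * (2 * (1 - p) + p / 3) + b * (s * (p / 3)) + s ^ 2 * (p / 3) ^ 2 := by
        positivity
      nlinarith
    · rw [h3] at hlt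
      have : 0 ≤ b + s * (2 * (1 - p) + p / 3) := by positivity
      linarith
  have h4 : a * s ≤ (b + s * (2 * (1 - p) + p / 3)) * s := mul_le_mul_of_nonneg_right key hs
  -- The terms in `u` add up to `(4 - 8p/3) u ≤ 4u`.
  nlinarith [mul_nonneg hu hp0]

/-! ### Expectations under discrete laws -/

open scoped ENNReal

namespace PMF

/-- Expectation of an extended nonnegative function under a discrete law. -/
noncomputable def expect {α : Type*} (p : PMF α) (g : α → ℝ≥0∞) : ℝ≥0∞ := ∑' a, p a * g a

theorem expect_pure {α : Type*} (a : α) (g : α → ℝ≥0∞) : (PMF.pure a).expect g = g a := by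
  classical
  rw [expect, tsum_eq_single a]
  · simp
  · intro b hb
    simp [PMF.pure_apply, hb]

theorem expect_bind {α β : Type*} (p : PMF α) (f : α → PMF β) (g : β → ℝ≥0∞) :
    (p.bind f).expect g = p.expect fun a => (f a).expect g := by
  simp only [expect, PMF.bind_apply, ← ENNReal.tsum_mul_right, ← ENNReal.tsum_mul_left]
  rw [ENNReal.tsum_comm]
  simp only [mul_assoc]

theorem expect_map {α β : Type*} (p : PMF α) (f : α → β) (g : β → ℝ≥0∞) :
    (p.map f).expect g = p.expect fun a => g (f a) := by
  rw [← PMF.bind_pure_comp, expect_bind]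
  simp [expect_pure]

theorem expect_const {α : Type*} (p : PMF α) (c : ℝ≥0∞) : (p.expect fun _ => c) = c := by
  rw [expect, ENNReal.tsum_mul_right, PMF.tsum_coe, one_mul]

theorem toOuterMeasure_le_expect {α : Type*} (p : PMF α) {s : Set α} {g : α → ℝ≥0∞}
    (h : ∀ a ∈ s, 1 ≤ g a) : p.toOuterMeasure s ≤ p.expect g := by
  rw [PMF.toOuterMeasure_apply]
  refine ENNReal.tsum_le_tsum fun a => ?_
  by_cases ha : a ∈ s
  · rw [Set.indicator_of_mem ha]
    exact le_mul_of_one_le_right' (h a ha)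
  · simp [Set.indicator_of_notMem ha]

theorem sum_toReal {α : Type*} [Fintype α] (p : PMF α) : ∑ a, (p a).toReal = 1 := by
  rw [← ENNReal.toReal_sum fun a _ => p.apply_ne_top a,
    ← tsum_fintype (L := .unconditional α), PMF.tsum_coe, ENNReal.toReal_one]

end PMF

/-! ### Successors of a fixed pair and the adaptive Chernoff bound -/

namespace PSafe

variable {S A : Type*}

/-- The successive states reached from the visits to `(x, a)`. -/
def nextStates [DecidableEq S] [DecidableEq A] (d : List (Transition S A)) (x : S) (a : A) : List S :=
  d.filterMap fun e => if e.1 = x ∧ e.2.1 = a then some e.2.2 else none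

section NextStates

variable [DecidableEq S] [DecidableEq A]

theorem nextStates_append (d d' : List (Transition S A)) (x : S) (a : A) :
    nextStates (d ++ d') x a = nextStates d x a ++ nextStates d' x a :=
  List.filterMap_append

theorem visits_eq_length (d : List (Transition S A)) (x : S) (a : A) :
    visits d x a = (nextStates d x a).length := by
  induction d with
  | nil => rfl
  | cons e d ih =>
    rw [visits, nextStates] at ih ⊢
    rw [List.countP_cons, List.filterMap_cons, ih]
    by_cases h : e.1 = x ∧ e.2.1 = a <;> simp [h]

theorem visitsTo_eq_countP (d : List (Transition S A)) (x : S) (a : A) (y : S) :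
    visitsTo d x a y = (nextStates d x a).countP (· = y) := by
  induction d with
  | nil => rfl
  | cons e d ih =>
    rw [visitsTo, nextStates] at ih ⊢
    rw [List.countP_cons, List.filterMap_cons, ih]
    by_cases h : e.1 = x ∧ e.2.1 = a
    · simp [h, List.countP_cons]
    · have h' : ¬(e.1 = x ∧ e.2.1 = a ∧ e.2.2 = y) := fun h3 => h ⟨h3.1, h3.2.1⟩
      simp [h, h']

theorem visits_append (d d' : List (Transition S A)) (x : S) (a : A) :
    visits (d ++ d') x a = visits d x a + visits d' x a :=
  List.countP_append

end NextStates

section Martingale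

variable [DecidableEq S] [DecidableEq A]

/-- The product of the weights of the first `n` visits to `(x, a)`, where visits that have not
yet occurred count with the mean weight `c`. -/
noncomputable def weight (z : S → ℝ≥0∞) (c : ℝ≥0∞) (n : ℕ) (x : S) (a : A) (d : List (Transition S A)) :
    ℝ≥0∞ :=
  c ^ (n - (nextStates d x a).length) * (((nextStates d x a).take n).map z).prod

/-- One of the first `n` visits trades a factor `c` for `z y`, whose mean is `c`; any other
transition changes nothing. This holds for every action `a'`, hence under any rule for choosing
actions. -/
theorem expect_weight_step (P : S → A → PMF S) (z : S → ℝ≥0∞) (n : ℕ) (x : S) (a : A)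
    (d : List (Transition S A)) (x' : S) (a' : A) :
    ((P x' a').expect fun y => weight z ((P x a).expect z) n x a (d ++ [(x', a', y)]))
      = weight z ((P x a).expect z) n x a d := by
  by_cases h : x' = x ∧ a' = a
  · obtain ⟨rfl, rfl⟩ := h
    have hn : ∀ y, nextStates (d ++ [(x', a', y)]) x' a' = nextStates d x' a' ++ [y] := by
      intro y
      rw [nextStates_append]
      simp [nextStates]
    simp only [weight, hn]
    set l := nextStates d x' a'
    by_cases hl : l.length < n
    · have ht : ∀ y, (l ++ [y]).take n = l ++ [y] := fun y =>
        List.take_of_length_le (by simpa using hl)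
      have hp : n - l.length = (n - (l.length + 1)) + 1 := by omega
      simp only [ht, List.take_of_length_le hl.le, List.map_append, List.prod_append,
        List.length_append, List.length_singleton, List.map_singleton, List.prod_singleton]
      rw [hp, pow_succ]
      simp only [PMF.expect]
      rw [mul_assoc, mul_comm (∑' y, _) _, ← mul_assoc, ← ENNReal.tsum_mul_left]
      refine tsum_congr fun y => ?_
      ring
    · have ht : ∀ y, (l ++ [y]).take n = l.take n := fun y => by
        rw [List.take_append_of_le_length (by omega)]
      have h1 : n - l.length = 0 := by omega
      have h2 : n - (l.length + 1) = 0 := by omega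
      simp [ht, h1, h2, PMF.expect_const]
  · have hn : ∀ y, nextStates (d ++ [(x', a', y)]) x a = nextStates d x a := by
      intro y
      rw [nextStates_append]
      simp [nextStates, h]
    simp only [weight, hn, PMF.expect_const]

theorem expect_weight_episode (P : S → A → PMF S) (H : Finset S) (z : S → ℝ≥0∞) (n : ℕ)
    (x : S) (a : A) (π : Policy S A) (T : ℕ) (x' : S) (d : List (Transition S A)) :
    ((episodeLaw P H π T x').expect fun e => weight z ((P x a).expect z) n x a (d ++ e))
      = weight z ((P x a).expect z) n x a d := by
  induction T generalizing x' d with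
  | zero => simp [episodeLaw, PMF.expect_pure]
  | succ T ih =>
    rw [episodeLaw]
    split_ifs with hx
    · simp only [PMF.expect_bind, PMF.expect_map]
      have step : ∀ (a' : A) (y : S), ((episodeLaw P H π T y).expect fun e =>
          weight z ((P x a).expect z) n x a (d ++ (x', a', y) :: e))
            = weight z ((P x a).expect z) n x a (d ++ [(x', a', y)]) := fun a' y => by
        simpa using ih y (d ++ [(x', a', y)])
      simp only [step, expect_weight_step, PMF.expect_const]
    · simp [PMF.expect_pure]

theorem expect_weight_run (P : S → A → PMF S) (H : Finset S)
    (learner : List (List (Transition S A)) → Policy S A) (T : ℕ) (x₀ : S) (z : S → ℝ≥0∞)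
    (n : ℕ) (x : S) (a : A) (K : ℕ) :
    ((runLaw P H learner T x₀ K).expect fun h => weight z ((P x a).expect z) n x a h.flatten)
      = ((P x a).expect z) ^ n := by
  induction K with
  | zero => simp [runLaw, PMF.expect_pure, weight, nextStates]
  | succ K ih =>
    simp only [runLaw, PMF.expect_bind, PMF.expect_map, List.flatten_append,
      List.flatten_singleton, expect_weight_episode]
    exact ih

/-- The weight at the end of the run depends only on the first `n` visits, so it equals the product
seen at any `k` with exactly `n` visits recorded. One use of Markov's inequality thus covers all
`k`. -/
theorem runLaw_weight_tail (P : S → A → PMF S) (H : Finset S)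
    (learner : List (List (Transition S A)) → Policy S A) (T : ℕ) (x₀ : S) (z : S → ℝ≥0∞)
    (n : ℕ) (x : S) (a : A) (K : ℕ) :
    (runLaw P H learner T x₀ K).toOuterMeasure
      {h | ∃ k, (nextStates (dataBefore h k) x a).length = n ∧
        1 ≤ ((nextStates (dataBefore h k) x a).map z).prod} ≤ ((P x a).expect z) ^ n := by
  rw [← expect_weight_run P H learner T x₀ z n x a K]
  refine PMF.toOuterMeasure_le_expect _ ?_
  rintro h ⟨k, hn, h1⟩
  have hd : h.flatten = dataBefore h k ++ (h.drop (k - 1)).flatten := by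
    rw [dataBefore, ← List.flatten_append, List.take_append_drop]
  have hlen : n - (nextStates h.flatten x a).length = 0 := by
    rw [hd, nextStates_append, List.length_append]
    omega
  have ht : (nextStates h.flatten x a).take n = nextStates (dataBefore h k) x a := by
    rw [hd, nextStates_append, List.take_append_of_le_length hn.ge,
      List.take_of_length_le hn.le]
  rw [weight, hlen, ht, pow_zero, one_mul]
  exact h1

/-- One-sided empirical Bernstein inequality at the time of the `n`-th visit to `(x, a)`. -/
theorem runLaw_empirical_bernstein [Fintype S] (P : S → A → PMF S) (H : Finset S)
    (learner : List (List (Transition S A)) → Policy S A) (T : ℕ) (x₀ : S)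
    (n : ℕ) (hn : 0 < n) (x : S) (a : A) (K : ℕ) (D : S → Prop) [DecidablePred D] {u r : ℝ}
    (hu : 0 ≤ u) (hr : r = ∑ y with D y, (P x a y).toReal) :
    (runLaw P H learner T x₀ K).toOuterMeasure
      {h | ∃ k, (nextStates (dataBefore h k) x a).length = n ∧ ∃ s : ℝ,
        s = ((nextStates (dataBefore h k) x a).countP (D ·) : ℝ) / n ∧
        2 * √(s * (1 - s) * u) + 4 * u < r - s} ≤ ENNReal.ofReal (Real.exp (-(2 * u * n))) := by
  have hsum : ∑ y, (P x a y).toReal = 1 := (P x a).sum_toReal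
  have hr0 : 0 ≤ r := hr ▸ Finset.sum_nonneg fun _ _ => ENNReal.toReal_nonneg
  have hsplit := Finset.sum_filter_add_sum_filter_not Finset.univ D fun y => (P x a y).toReal
  rw [hsum, ← hr] at hsplit
  have hr1 : r ≤ 1 := by
    have : 0 ≤ ∑ y with ¬ D y, (P x a y).toReal :=
      Finset.sum_nonneg fun _ _ => ENNReal.toReal_nonneg
    linarith
  rcases hr0.eq_or_lt with h0 | h0
  · refine (le_of_eq ?_).trans (zero_le (a := _))
    convert MeasureTheory.measure_empty (μ := (runLaw P H learner T x₀ K).toOuterMeasure)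
    rw [Set.eq_empty_iff_forall_notMem]
    rintro h ⟨k, -, s, hs, hlt⟩
    have : 0 ≤ s := hs ▸ by positivity
    have := Real.sqrt_nonneg (s * (1 - s) * u)
    linarith
  obtain ⟨l, hl, hmgf⟩ := exists_bernoulli_chernoff h0 hr1 hu
  set m := 2 * √(r * (1 - r) * u) + 2 * u * r / 3 with hm
  -- The product of these weights over `n` visits is at least `1` as soon as the frequency of `D`
  -- falls short of `r` by at least `m`.
  set z : S → ℝ≥0∞ := fun y => ENNReal.ofReal (Real.exp (l * (r - m - if D y then 1 else 0)))
    with hz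
  have hprod : ∀ L : List S, (L.map z).prod =
      ENNReal.ofReal (Real.exp (l * (L.length * (r - m) - L.countP (D ·)))) := by
    intro L
    induction L with
    | nil => simp
    | cons y L ih =>
      rw [List.map_cons, List.prod_cons, ih, hz, ← ENNReal.ofReal_mul (Real.exp_nonneg _),
        ← Real.exp_add]
      congr 2
      by_cases hy : D y <;> simp [hy] <;> ring
  have hexp : (P x a).expect z ≤ ENNReal.ofReal (Real.exp (-(2 * u))) := by
    have : (P x a).expect z = ENNReal.ofReal
        (∑ y, (P x a y).toReal * Real.exp (l * (r - m - if D y then 1 else 0))) := by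
      rw [PMF.expect, tsum_fintype, ENNReal.ofReal_sum_of_nonneg fun y _ =>
        mul_nonneg ENNReal.toReal_nonneg (Real.exp_nonneg _)]
      refine Finset.sum_congr rfl fun y _ => ?_
      rw [ENNReal.ofReal_mul ENNReal.toReal_nonneg, ENNReal.ofReal_toReal (PMF.apply_ne_top _ _)]
    rw [this]
    refine ENNReal.ofReal_le_ofReal (le_trans (le_of_eq ?_) hmgf)
    rw [← Finset.sum_filter_add_sum_filter_not Finset.univ D]
    have e1 : ∑ y with D y, (P x a y).toReal * Real.exp (l * (r - m - if D y then 1 else 0))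
        = r * Real.exp (l * (r - m - 1)) := by
      rw [hr, Finset.sum_mul, ← hr]
      refine Finset.sum_congr rfl fun y hy => ?_
      rw [if_pos (Finset.mem_filter.1 hy).2]
    have e2 : ∑ y with ¬ D y, (P x a y).toReal * Real.exp (l * (r - m - if D y then 1 else 0))
        = (1 - r) * Real.exp (l * (r - m)) := by
      rw [← hsplit, add_sub_cancel_left, Finset.sum_mul]
      refine Finset.sum_congr rfl fun y hy => ?_
      rw [if_neg (Finset.mem_filter.1 hy).2, sub_zero]
    rw [e1, e2, add_comm]
  have hn' : (0 : ℝ) < n := by exact_mod_cast hn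
  calc
    _ ≤ (runLaw P H learner T x₀ K).toOuterMeasure {h | ∃ k, (nextStates (dataBefore h k) x a).length = n ∧
        1 ≤ ((nextStates (dataBefore h k) x a).map z).prod} := by
        refine MeasureTheory.measure_mono ?_
        rintro h ⟨k, hk, s, hs, hlt⟩
        refine ⟨k, hk, ?_⟩
        have hs0 : 0 ≤ s := hs ▸ by positivity
        have hms : m < r - s := by
          by_contra! hcon
          have := Real.sqrt_nonneg (s * (1 - s) * u)
          exact absurd (sub_le_of_bernstein hr1 hs0 (by linarith) hu hcon) (not_le.2 hlt)
        rw [hprod, ENNReal.one_le_ofReal, Real.one_le_exp_iff, hk]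
        refine mul_nonneg hl ?_
        have : ((nextStates (dataBefore h k) x a).countP (D ·) : ℝ) = n * s := by
          rw [hs]; field_simp
        rw [this]
        nlinarith
    _ ≤ ((P x a).expect z) ^ n := runLaw_weight_tail P H learner T x₀ z n x a K
    _ ≤ ENNReal.ofReal (Real.exp (-(2 * u))) ^ n := by gcongr
    _ = _ := by
      rw [← ENNReal.ofReal_pow (Real.exp_nonneg _), ← Real.exp_nat_mul]
      congr 2
      ring

end Martingale

/-! ### Absence of cycles and the number of visits -/

section Acyclic

/-- One-step accessibility from a state of `H`. -/
def Step (P : S → A → PMF S) (H : Finset S) (x y : S) : Prop :=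
  x ∈ H ∧ ∃ a, P x a y ≠ 0

/-- The uniform policy gives every action positive probability, so it can go round the cycle for any
number of steps. -/
theorem exists_path_of_cycle [Fintype A] [Nonempty A] {P : S → A → PMF S} {H : Finset S} {x : S}
    (hx : x ∈ H) (hc : Relation.TransGen (Step P H) x x) (n : ℕ) {y : S}
    (hy : y = x ∨ Relation.TransGen (Step P H) y x) :
    ∃ l ∈ (stateLaw P (fun _ => PMF.uniformOfFintype A) n y).support, ∀ z ∈ l, z ∈ H := by
  replace hy : Relation.TransGen (Step P H) y x := by
    rcases hy with rfl | hy
    exacts [hc, hy]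
  induction n generalizing y with
  | zero =>
    refine ⟨[y], by simp [stateLaw], ?_⟩
    obtain ⟨z, hz, -⟩ := Relation.TransGen.head'_iff.1 hy
    simpa using hz.1
  | succ n ih =>
    obtain ⟨z, ⟨hyH, a, ha⟩, hzx⟩ := Relation.TransGen.head'_iff.1 hy
    have hz : Relation.TransGen (Step P H) z x := by
      rcases Relation.reflTransGen_iff_eq_or_transGen.1 hzx with rfl | h
      exacts [hc, h]
    obtain ⟨l, hl, hlH⟩ := ih hz
    refine ⟨y :: l, ?_, ?_⟩
    · simp only [stateLaw, PMF.mem_support_bind_iff, PMF.mem_support_map_iff]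
      exact ⟨a, by simp, z, ha, l, hl, rfl⟩
    · simpa using ⟨hyH, hlH⟩

variable [DecidableEq S]

theorem StopsBy.not_transGen [Fintype S] [Fintype A] [Nonempty A] {P : S → A → PMF S}
    {E U : Finset S} {n : ℕ} (hτ : StopsBy P E U n) {x : S} (hx : x ∈ taboo E U) :
    ¬ Relation.TransGen (Step P (taboo E U)) x x := by
  intro hc
  obtain ⟨l, hl, hlH⟩ := exists_path_of_cycle hx hc n (Or.inl rfl)
  have h1 := hτ (fun _ => PMF.uniformOfFintype A) x
  rw [prob, ENNReal.toReal_eq_one_iff, PMF.toOuterMeasure_apply_eq_one_iff] at h1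
  obtain ⟨y, hyl, hy⟩ := h1 hl
  exact (Finset.mem_compl.1 (hlH y hyl)) hy

theorem reflTransGen_of_mem_episode {P : S → A → PMF S} {H : Finset S} {π : Policy S A} {n : ℕ}
    {x : S} {l : List (Transition S A)} (hl : l ∈ (episodeLaw P H π n x).support)
    {e : Transition S A} (he : e ∈ l) : Relation.ReflTransGen (Step P H) x e.1 := by
  induction n generalizing x l with
  | zero =>
    rw [episodeLaw, PMF.mem_support_pure_iff] at hl
    simp [hl] at he
  | succ n ih =>
    rw [episodeLaw] at hl
    split_ifs at hl with hx
    · simp only [PMF.mem_support_bind_iff, PMF.mem_support_map_iff] at hl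
      obtain ⟨a, -, y, hy, l, hl, rfl⟩ := hl
      rcases List.mem_cons.1 he with rfl | he
      · exact .refl
      · exact .head ⟨hx, a, hy⟩ (ih hl he)
    · rw [PMF.mem_support_pure_iff] at hl
      simp [hl] at he

/-- Every state recorded after a visit to `x` is accessible from the successor of `x`, so a second
visit would close a cycle. -/
theorem visits_episode_le_one [DecidableEq A] {P : S → A → PMF S} {H : Finset S}
    {π : Policy S A} {n : ℕ} {x' x : S} (a : A)
    (hx : ¬ Relation.TransGen (Step P H) x x) {l : List (Transition S A)}
    (hl : l ∈ (episodeLaw P H π n x').support) : visits l x a ≤ 1 := by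
  induction n generalizing x' l with
  | zero =>
    rw [episodeLaw, PMF.mem_support_pure_iff] at hl
    simp [hl, visits]
  | succ n ih =>
    rw [episodeLaw] at hl
    split_ifs at hl with hx'
    · simp only [PMF.mem_support_bind_iff, PMF.mem_support_map_iff] at hl
      obtain ⟨a', -, y, hy, l, hl, rfl⟩ := hl
      by_cases hxx : x' = x
      · subst hxx
        have h0 : visits l x' a = 0 := by
          rw [visits, List.countP_eq_zero]
          intro e he
          have hr := reflTransGen_of_mem_episode hl he
          have hne : e.1 ≠ x' := fun h =>
            hx (Relation.TransGen.head' ⟨hx', a', hy⟩ (h ▸ hr))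
          simp [hne]
        rw [visits, List.countP_cons, ← visits, h0]
        split_ifs <;> simp
      · rw [visits, List.countP_cons_of_neg (by simp [hxx])]
        exact ih hl
    · rw [PMF.mem_support_pure_iff] at hl
      simp [hl, visits]

theorem exists_episode_of_mem_run {P : S → A → PMF S} {H : Finset S}
    {learner : List (List (Transition S A)) → Policy S A} {T : ℕ} {x₀ : S} {K : ℕ}
    {h : List (List (Transition S A))} (hh : h ∈ (runLaw P H learner T x₀ K).support)
    {e : List (Transition S A)} (he : e ∈ h) :
    ∃ π, e ∈ (episodeLaw P H π T x₀).support := by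
  induction K generalizing h with
  | zero =>
    rw [runLaw, PMF.mem_support_pure_iff] at hh
    simp [hh] at he
  | succ K ih =>
    simp only [runLaw, PMF.mem_support_bind_iff, PMF.mem_support_map_iff] at hh
    obtain ⟨g, hg, f, hf, rfl⟩ := hh
    rcases List.mem_append.1 he with he | he
    · exact ih hg he
    · rw [List.mem_singleton] at he
      exact ⟨_, he ▸ hf⟩

theorem visits_flatten_le [DecidableEq A] (x : S) (a : A) {h : List (List (Transition S A))}
    (hh : ∀ e ∈ h, visits e x a ≤ 1) : visits h.flatten x a ≤ h.length := by
  induction h with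
  | nil => simp [visits]
  | cons e h ih =>
    rw [List.flatten_cons, visits_append, List.length_cons]
    have := hh e (by simp)
    have := ih fun e he => hh e (by simp [he])
    omega

/-- A state-action pair is visited at most once per episode. -/
theorem StopsBy.visits_dataBefore_le [Fintype S] [Fintype A] [Nonempty A] [DecidableEq A]
    {P : S → A → PMF S} {E U : Finset S} {n : ℕ} (hτ : StopsBy P E U n)
    {learner : List (List (Transition S A)) → Policy S A} {T : ℕ} {x₀ : S} {K : ℕ}
    {h : List (List (Transition S A))}
    (hh : h ∈ (runLaw P (taboo E U) learner T x₀ K).support) {x : S} (hx : x ∈ taboo E U)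
    (a : A) (k : ℕ) : visits (dataBefore h k) x a ≤ k - 1 := by
  refine (visits_flatten_le x a fun e he => ?_).trans (List.length_take_le _ _)
  obtain ⟨π, hπ⟩ := exists_episode_of_mem_run hh (List.mem_of_mem_take he)
  exact visits_episode_le_one a (hτ.not_transGen hx) hπ

end Acyclic

end PSafe

/-! ### Deviation events and the union bound -/

namespace PSafe

variable {S A : Type*} [Fintype S] [Fintype A]

theorem exp_logTerm [Nonempty S] [Nonempty A] {K : ℕ} {w : ℝ} (hK : 0 < K) (hw0 : 0 < w) :
    Real.exp (logTerm S A K w) = 2 * Fintype.card S * Fintype.card A * K / w := by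
  have hS : 0 < Fintype.card S := Fintype.card_pos
  have hA : 0 < Fintype.card A := Fintype.card_pos
  rw [logTerm, Real.exp_log (by positivity)]

theorem half_le_logTerm [Nonempty S] [Nonempty A] {K : ℕ} {w : ℝ} (hK : 0 < K) (hw0 : 0 < w)
    (hw1 : w < 1) : 1 / 2 ≤ logTerm S A K w := by
  have hS : (1 : ℝ) ≤ Fintype.card S := by exact_mod_cast Fintype.card_pos
  have hA : (1 : ℝ) ≤ Fintype.card A := by exact_mod_cast Fintype.card_pos
  have hK' : (1 : ℝ) ≤ K := by exact_mod_cast hK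
  have h2 : (2 : ℝ) ≤ 2 * Fintype.card S * Fintype.card A * K / w := by
    rw [le_div_iff₀ hw0]
    have : (1 : ℝ) ≤ Fintype.card S * Fintype.card A * K :=
      one_le_mul_of_one_le_of_one_le (one_le_mul_of_one_le_of_one_le hS hA) hK'
    nlinarith
  have := Real.log_le_log (by norm_num) h2
  have := Real.log_two_gt_d9
  rw [logTerm]
  linarith

variable [DecidableEq S] [DecidableEq A]

theorem radius_nonneg {K : ℕ} {w : ℝ} (hL : 0 ≤ logTerm S A K w) (d : List (Transition S A))
    (x : S) (a : A) (y : S) : 0 ≤ radius K w d x a y := by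
  unfold radius
  have : (0 : ℝ) < max ((visits d x a : ℝ) - 1) 1 := lt_max_of_lt_right one_pos
  positivity

/-- With `u = L / n` the square-root terms coincide, and `4 ≤ 14/3` settles the linear ones. -/
theorem bernstein_le_radius {K : ℕ} {w : ℝ} (hL : 0 ≤ logTerm S A K w)
    (d : List (Transition S A)) (x : S) (a : A) (y : S) (hn : 0 < visits d x a) :
    2 * √(estP d x a y * (1 - estP d x a y) * (logTerm S A K w / visits d x a))
      + 4 * (logTerm S A K w / visits d x a) ≤ radius K w d x a y := by
  have hn' : (1 : ℝ) ≤ visits d x a := by exact_mod_cast hn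
  unfold radius
  rw [max_eq_left hn']
  set s := estP d x a y
  set n : ℝ := (visits d x a : ℝ)
  set L := logTerm S A K w
  have e : 4 * s * (1 - s) * L / n = 2 ^ 2 * (s * (1 - s) * (L / n)) := by ring
  rw [e, Real.sqrt_mul (x := 2 ^ 2) (by norm_num), Real.sqrt_sq (x := 2) (by norm_num)]
  have hmax : max (n - 1) 1 ≤ n := max_le (by linarith) hn'
  have hpos : 0 < max (n - 1) 1 := lt_max_of_lt_right one_pos
  have : 14 * L / (3 * n) ≤ 14 * L / (3 * max (n - 1) 1) := by gcongr
  have : 4 * (L / n) ≤ 14 * L / (3 * n) := by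
    have : 14 * L / (3 * n) = 14 / 3 * (L / n) := by ring
    rw [this]
    have : 0 ≤ L / n := by positivity
    linarith
  linarith

/-- At the time of the `n`-th visit to `(x, a)`, the estimate of `P(x, a, y)` lies outside the
Bernstein radius, from below if `b` holds and from above otherwise. -/
def deviation (P : S → A → PMF S) (K : ℕ) (w : ℝ) (x : S) (a : A) (y : S) (b : Bool) (n : ℕ) :
    Set (List (List (Transition S A))) :=
  {h | ∃ k, visits (dataBefore h k) x a = n ∧
    radius K w (dataBefore h k) x a y <
      if b then (P x a y).toReal - estP (dataBefore h k) x a y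
      else estP (dataBefore h k) x a y - (P x a y).toReal}

theorem runLaw_deviation_le (P : S → A → PMF S) (H : Finset S)
    (learner : List (List (Transition S A)) → Policy S A) (T : ℕ) (x₀ : S) {K : ℕ} {w : ℝ}
    (hL : 0 ≤ logTerm S A K w) (x : S) (a : A) (y : S) (b : Bool) {n : ℕ} (hn : 0 < n) :
    (runLaw P H learner T x₀ K).toOuterMeasure (deviation P K w x a y b n)
      ≤ ENNReal.ofReal (Real.exp (-(2 * logTerm S A K w))) := by
  have hn' : (1 : ℝ) ≤ n := by exact_mod_cast hn
  have hu : 0 ≤ logTerm S A K w / n := by positivity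
  have e : 2 * (logTerm S A K w / n) * n = 2 * logTerm S A K w := by field_simp
  have hsum : ∑ y, (P x a y).toReal = 1 := (P x a).sum_toReal
  cases b with
  | true =>
    have h := runLaw_empirical_bernstein P H learner T x₀ n hn x a K (· = y) hu
      (r := (P x a y).toReal) (by simp [Finset.filter_eq'])
    rw [e] at h
    refine (MeasureTheory.measure_mono ?_).trans h
    rintro g ⟨k, hk, hlt⟩
    refine ⟨k, visits_eq_length _ x a ▸ hk, estP (dataBefore g k) x a y, ?_, ?_⟩
    · rw [estP, hk, max_eq_left hn', visitsTo_eq_countP]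
    · have := bernstein_le_radius hL (dataBefore g k) x a y (hk ▸ hn)
      rw [hk] at this
      exact this.trans_lt (by simpa using hlt)
  | false =>
    -- Overestimating `y` is underestimating its complement, and the variance is unchanged under `s
    -- ↦ 1 - s`.
    have h := runLaw_empirical_bernstein P H learner T x₀ n hn x a K (fun z => ¬ z = y) hu
      (r := 1 - (P x a y).toReal) (by
        have := Finset.sum_filter_add_sum_filter_not Finset.univ (· = y)
          fun y => (P x a y).toReal
        rw [hsum, Finset.filter_eq', if_pos (Finset.mem_univ _), Finset.sum_singleton] at this
        linarith)
    rw [e] at h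
    refine (MeasureTheory.measure_mono ?_).trans h
    rintro g ⟨k, hk, hlt⟩
    have hlen := visits_eq_length (dataBefore g k) x a ▸ hk
    refine ⟨k, hlen, 1 - estP (dataBefore g k) x a y, ?_, ?_⟩
    · rw [estP, hk, max_eq_left hn', visitsTo_eq_countP, eq_div_iff (by positivity), sub_mul,
        div_mul_cancel₀ _ (by positivity), one_mul, sub_eq_iff_eq_add]
      have := List.length_eq_countP_add_countP (fun z => decide (z = y))
        (l := nextStates (dataBefore g k) x a)
      rw [hlen] at this
      rw [this]
      push_cast
      simp [add_comm]
    · have := bernstein_le_radius hL (dataBefore g k) x a y (hk ▸ hn)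
      rw [hk] at this
      rw [sub_sub_cancel, mul_comm (1 - _)]
      simp only [Bool.false_eq_true, if_false] at hlt
      linarith

/-- Outside the deviation events, the estimate lies within its radius. -/
theorem abs_sub_estP_le [Nonempty S] [Nonempty A] {P : S → A → PMF S} {K : ℕ} {w : ℝ}
    (hL : 1 / 2 ≤ logTerm S A K w) {h : List (List (Transition S A))} {k : ℕ} {x : S} {a : A}
    (y : S) (hv : visits (dataBefore h k) x a ≤ K - 1)
    (hdev : ∀ b, ∀ n ∈ Finset.Icc 1 (K - 1), h ∉ deviation P K w x a y b n) :
    |(P x a y).toReal - estP (dataBefore h k) x a y| ≤ radius K w (dataBefore h k) x a y := by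
  rcases Nat.eq_zero_or_pos (visits (dataBefore h k) x a) with h0 | h0
  · have hz : visitsTo (dataBefore h k) x a y = 0 := by
      rw [visits_eq_length, List.length_eq_zero_iff] at h0
      rw [visitsTo_eq_countP, h0, List.countP_nil]
    have hp : (P x a y).toReal ≤ 1 := by
      simpa using ENNReal.toReal_mono ENNReal.one_ne_top (PMF.coe_le_one (P x a) y)
    have hp0 : 0 ≤ (P x a y).toReal := ENNReal.toReal_nonneg
    simp only [radius, estP, hz, h0, Nat.cast_zero, zero_div, sub_zero, mul_zero, zero_mul,
      Real.sqrt_zero, zero_add]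
    -- Without data the estimate is `0` and the radius is `14L/3 ≥ 7/3`, so the bound is trivial.
    rw [abs_of_nonneg hp0, max_eq_right (by norm_num)]
    linarith
  · have hmem : visits (dataBefore h k) x a ∈ Finset.Icc 1 (K - 1) := Finset.mem_Icc.2 ⟨h0, hv⟩
    rw [abs_sub_le_iff]
    constructor <;> by_contra! hlt
    · exact hdev true _ hmem ⟨k, rfl, by simpa using hlt⟩
    · exact hdev false _ hmem ⟨k, rfl, by simpa using hlt⟩

end PSafe

theorem mainTheorem4 {S A : Type*} [Fintype S] [DecidableEq S] [Fintype A] [DecidableEq A]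
    (P : S → A → PMF S) (E U : Finset S) (hEU : Disjoint E U)
    (τmax T : ℕ) (hτ : PSafe.StopsBy P E U τmax) (hT : τmax ≤ T)
    (x₀ : S) (hx₀ : x₀ ∈ PSafe.taboo E U)
    (learner : List (List (PSafe.Transition S A)) → PSafe.Policy S A)
    (K : ℕ) (w : ℝ) (hw0 : 0 < w) (hw1 : w < 1) :
    1 - 2 * w ≤ PSafe.prob (PSafe.runLaw P (PSafe.taboo E U) learner T x₀ K)
      {h | ∀ k ∈ Finset.Icc 1 K, ∀ x ∈ PSafe.taboo E U, ∀ (a : A),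
        (∀ y : S, |(P x a y).toReal - PSafe.estP (PSafe.dataBefore h k) x a y|
            ≤ PSafe.radius K w (PSafe.dataBefore h k) x a y) ∧
        (∀ Q ∈ PSafe.confidenceSet (PSafe.taboo E U) K w (PSafe.dataBefore h k), ∀ y : S,
          |(P x a y).toReal - Q x a y| ≤ 2 * PSafe.radius K w (PSafe.dataBefore h k) x a y) ∧
        PSafe.kappa P U x a ≤ PSafe.estKappa (PSafe.dataBefore h k) U x a
          + PSafe.radiusSum K w (PSafe.dataBefore h k) x a} := by
  open PSafe in
  have : Nonempty S := ⟨x₀⟩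
  have : Nonempty A := (learner [] x₀).support_nonempty.to_type
  set μ := runLaw P (taboo E U) learner T x₀ K with hμ
  set G := {h : List (List (Transition S A)) | ∀ k ∈ Finset.Icc 1 K, ∀ x ∈ taboo E U, ∀ (a : A),
        (∀ y : S, |(P x a y).toReal - estP (dataBefore h k) x a y|
            ≤ radius K w (dataBefore h k) x a y) ∧
        (∀ Q ∈ confidenceSet (taboo E U) K w (dataBefore h k), ∀ y : S,
          |(P x a y).toReal - Q x a y| ≤ 2 * radius K w (dataBefore h k) x a y) ∧
        kappa P U x a ≤ estKappa (dataBefore h k) U x a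
          + radiusSum K w (dataBefore h k) x a} with hG
  have hfin : μ.toOuterMeasure G ≠ ∞ :=
    ((μ.toOuterMeasure_mono (Set.inter_subset_left.trans (Set.subset_univ G))).trans_lt
      ((μ.toOuterMeasure_apply_eq_one_iff _).2 (Set.subset_univ _) ▸ ENNReal.one_lt_top)).ne
  rcases Nat.eq_zero_or_pos K with hK | hK
  · have : μ.toOuterMeasure G = 1 := by
      rw [PMF.toOuterMeasure_apply_eq_one_iff]
      intro h _ k hk
      simp [hK] at hk
    rw [prob, this, ENNReal.toReal_one]
    linarith
  have hL : 1 / 2 ≤ logTerm S A K w := half_le_logTerm hK hw0 hw1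
  have hL0 : 0 ≤ logTerm S A K w := by linarith
  let I : Finset ((S × A × S × Bool) × ℕ) := Finset.univ ×ˢ Finset.Icc 1 (K - 1)
  let B : (S × A × S × Bool) × ℕ → Set (List (List (Transition S A))) :=
    fun i => deviation P K w i.1.1 i.1.2.1 i.1.2.2.1 i.1.2.2.2 i.2
  have hbad : μ.toOuterMeasure Gᶜ ≤ ENNReal.ofReal w := by
    -- The bound on visits holds only for runs of positive probability, hence the restriction to the
    -- support.
    have hsub : Gᶜ ∩ μ.support ⊆ ⋃ i ∈ I, B i := by
      rintro h ⟨hG', hsupp⟩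
      by_contra hB
      refine hG' fun k hk x hx a => ?_
      have hv : visits (dataBefore h k) x a ≤ K - 1 :=
        (hτ.visits_dataBefore_le hsupp hx a k).trans
          (Nat.sub_le_sub_right (Finset.mem_Icc.1 hk).2 1)
      have h1 : ∀ y, |(P x a y).toReal - estP (dataBefore h k) x a y|
          ≤ radius K w (dataBefore h k) x a y := fun y =>
        abs_sub_estP_le hL y hv fun b n hn hd => hB <| Set.mem_biUnion
          (x := ((x, a, y, b), n)) (by simpa [I] using hn) hd
      refine ⟨h1, fun Q hQ y => ?_, ?_⟩
      · have h2 := hQ.2 x hx a y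
        rw [abs_sub_comm] at h2
        calc _ ≤ _ := abs_sub_le _ (estP (dataBefore h k) x a y) _
          _ ≤ _ := by linarith [h1 y]
      · calc kappa P U x a
            ≤ ∑ y ∈ U, (estP (dataBefore h k) x a y + radius K w (dataBefore h k) x a y) :=
              Finset.sum_le_sum fun y _ => by linarith [(abs_sub_le_iff.1 (h1 y)).1]
          _ = estKappa (dataBefore h k) U x a + ∑ y ∈ U, radius K w (dataBefore h k) x a y :=
              Finset.sum_add_distrib
          _ ≤ _ := by
              gcongr
              exact Finset.sum_le_sum_of_subset_of_nonneg (Finset.subset_univ U)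
                fun y _ _ => radius_nonneg hL0 _ x a y
    calc μ.toOuterMeasure Gᶜ ≤ μ.toOuterMeasure (⋃ i ∈ I, B i) := μ.toOuterMeasure_mono hsub
      _ ≤ ∑ i ∈ I, μ.toOuterMeasure (B i) := MeasureTheory.measure_biUnion_finset_le _ _
      _ ≤ ∑ i ∈ I, ENNReal.ofReal (Real.exp (-(2 * logTerm S A K w))) :=
          Finset.sum_le_sum fun i hi => runLaw_deviation_le P _ learner T x₀ hL0 _ _ _ _
            (Finset.mem_Icc.1 (Finset.mem_product.1 hi).2).1
      _ = ENNReal.ofReal (I.card * Real.exp (-(2 * logTerm S A K w))) := by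
          rw [Finset.sum_const, nsmul_eq_mul, ENNReal.ofReal_mul (by positivity),
            ENNReal.ofReal_natCast]
      _ ≤ ENNReal.ofReal w := by
          refine ENNReal.ofReal_le_ofReal ?_
          have hS : (1 : ℝ) ≤ Fintype.card S := by exact_mod_cast Fintype.card_pos
          have hA : (1 : ℝ) ≤ Fintype.card A := by exact_mod_cast Fintype.card_pos
          have hK' : (1 : ℝ) ≤ K := by exact_mod_cast hK
          have hI : (I.card : ℝ) ≤ Fintype.card S * (Fintype.card A * (Fintype.card S * 2)) * K := by
            have : I.card ≤ Fintype.card S * (Fintype.card A * (Fintype.card S * 2)) * K := by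
              simp only [I, Finset.card_product, Finset.card_univ, Fintype.card_prod,
                Fintype.card_bool, Nat.card_Icc]
              exact Nat.mul_le_mul_left _ (by omega)
            exact_mod_cast this
          rw [Real.exp_neg, two_mul, Real.exp_add, exp_logTerm hK hw0, ← div_eq_mul_inv,
            div_le_iff₀ (by positivity)]
          refine hI.trans ?_
          set s := (Fintype.card S : ℝ)
          set a := (Fintype.card A : ℝ)
          -- The total failure probability is at most `w² / (2|A|K) ≤ w`: the squared exponential
          -- absorbs the second factor `|S|` of the union bound.
          have e : w * (2 * s * a * K / w * (2 * s * a * K / w))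
              = s * (a * (s * 2)) * K * (2 * (a * K) / w) := by
            field_simp
          rw [e]
          refine le_mul_of_one_le_right (by positivity) ?_
          rw [le_div_iff₀ hw0]
          nlinarith [one_le_mul_of_one_le_of_one_le hA hK']
  have hone : (1 : ℝ≥0∞) ≤ μ.toOuterMeasure G + ENNReal.ofReal w := by
    calc (1 : ℝ≥0∞) = μ.toOuterMeasure (G ∪ Gᶜ) :=
          ((μ.toOuterMeasure_apply_eq_one_iff _).2 (by simp)).symm
      _ ≤ μ.toOuterMeasure G + μ.toOuterMeasure Gᶜ := MeasureTheory.measure_union_le _ _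
      _ ≤ _ := by gcongr
  have := ENNReal.toReal_mono (ENNReal.add_ne_top.2 ⟨hfin, ENNReal.ofReal_ne_top⟩) hone
  rw [ENNReal.toReal_one, ENNReal.toReal_add hfin ENNReal.ofReal_ne_top,
    ENNReal.toReal_ofReal hw0.le] at this
  rw [prob]
  linarith
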